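/- For $n\ge 1$ consider $n$ pairs of cards labelled $1,\dots,n$, each pair consisting of a blue and a red card with the same label. A game of size $n$ is a permutation of these $2n$ cards in which, for every label, the blue card precedes the red card. The $n$ red cards split the game into $n$ blocks of consecutive cards: the first block consists of the cards up to and including the first red card, and for $2\le i\le n$ the $i$-th block consists of the cards after the $(i-1)$-st red card up to and including the $i$-th red card. Let $D_{n,i}$ be the length (number of cards) of the $i$-th block in a uniformly random game of size $n$. Then for every fixed integer $k\ge 1$, as $n\to\infty$, \[ \left(\frac{D_{n,1}}{2\sqrt n},\dots,\frac{D_{n,k}}{2\sqrt n}\right)\stackrel{d}{\longrightarrow}(X_1,\dots,X_k), \] where $(X_1,\dots,X_k)$ is a random vector with joint probability density function (with respect to Lebesgue measure on $\mathbb R^k$) \[ f(x_1,\dots,x_k)=\begin{cases}2^k\,x_1(x_1+x_2)\cdots(x_1+\cdots+x_k)\,e^{-(x_1+\cdots+x_k)^2} & \text{if } x_1,\dots,x_k\ge 0,\\ 0&\text{otherwise.}\end{cases} \] In particular, $f$ is a probability density. -/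

import Mathlib

open MeasureTheory Filter

noncomputable section

namespace MemoryGame

/-- The `2n` cards of a game of size `n`: a card is a label together with a colour,
where `false` is blue and `true` is red. -/
abbrev Card (n : ℕ) : Type := Fin n × Bool

/-- A game with `n` pairs of cards: a permutation of the `2n` cards (`σ p` is the card at
position `p`) in which every blue card precedes the red card with the same label. -/
def Deal (n : ℕ) : Type :=
  {σ : Fin (2 * n) ≃ Card n // ∀ a : Fin n, σ.symm (a, false) < σ.symm (a, true)}

instance (n : ℕ) : Fintype (Deal n) :=
  inferInstanceAs (Fintype
    {σ : Fin (2 * n) ≃ Card n // ∀ a : Fin n, σ.symm (a, false) < σ.symm (a, true)})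

instance (n : ℕ) : Nonempty (Deal n) := by
  let e : Card n ≃ Fin (2 * n) :=
    ((Equiv.refl (Fin n)).prodCongr finTwoEquiv.symm).trans
      (finProdFinEquiv.trans (finCongr (Nat.mul_comm n 2)))
  refine ⟨⟨e.symm, fun a => ?_⟩⟩
  simp [e, Fin.lt_def, finTwoEquiv]

/-- Every event is measurable. -/
instance (n : ℕ) : MeasurableSpace (Deal n) := ⊤

/-- The uniform distribution on the games with `n` pairs of cards. -/
def randomGame (n : ℕ) : Measure (Deal n) :=
  (PMF.uniformOfFintype (Deal n)).toMeasure

instance (n : ℕ) : IsProbabilityMeasure (randomGame n) :=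
  inferInstanceAs (IsProbabilityMeasure (PMF.uniformOfFintype (Deal n)).toMeasure)

/-- The position `p` carries a red card. -/
def Deal.IsRed {n : ℕ} (σ : Deal n) (p : Fin (2 * n)) : Prop := (σ.1 p).2 = true

instance {n : ℕ} (σ : Deal n) (p : Fin (2 * n)) : Decidable (σ.IsRed p) :=
  inferInstanceAs (Decidable ((σ.1 p).2 = true))

/-- The block with index `i` (counted from `0`): the positions that have exactly `i` red cards
strictly before them. For `i < n` these are the consecutive positions after the `i`-th red card
(from the start, if `i = 0`), up to and including the `(i + 1)`-st red card; for `n ≤ i`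
there are none. -/
def Deal.block {n : ℕ} (σ : Deal n) (i : ℕ) : Finset (Fin (2 * n)) :=
  {p | (Finset.univ.filter fun q => q < p ∧ σ.IsRed q).card = i}

/-- The length of the block with index `i` (counted from `0`). -/
def Deal.blockLength {n : ℕ} (σ : Deal n) (i : ℕ) : ℕ := (σ.block i).card

/-- The lengths of the first `k` blocks, divided by `2√n`. -/
def scaledBlockLengths (k n : ℕ) (σ : Deal n) : Fin k → ℝ :=
  fun i => (σ.blockLength i : ℝ) / (2 * √(n : ℝ))

open Classical in
/-- The function `2^k x₁ (x₁ + x₂) ⋯ (x₁ + ⋯ + x_k) exp (-(x₁ + ⋯ + x_k)²)` on the orthant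
of vectors with nonnegative coordinates, and `0` elsewhere. -/
def limitDensity (k : ℕ) (x : Fin k → ℝ) : ℝ :=
  if ∀ i, 0 ≤ x i then
    2 ^ k * (∏ i : Fin k, ∑ j ∈ Finset.Iic i, x j) * Real.exp (-(∑ j, x j) ^ 2)
  else 0

/-- The measure on `ℝᵏ` with density `limitDensity k` with respect to Lebesgue measure. -/
def limitLaw (k : ℕ) : Measure (Fin k → ℝ) :=
  volume.withDensity fun x => ENNReal.ofReal (limitDensity k x)

end MemoryGame

end

/-! Since the limit law has total mass one (`lintegral_limitDensity`), the portmanteau theorem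
reduces the claim to a lower bound for the liminf of the probabilities of open sets. So
probabilities only ever need to be bounded from below.

Tossing a coin for each label turns a uniform game into a uniform arrangement of all cards, and
"red" becomes "second of its pair" (`bijective_recolour`, `isRed_iff`). If r of the first p cards
are red, then p - 2r pairs are open, and by exchangeability of the remaining positions the next card
is red with probability (p - 2r)/(2n - p). For blocks of order √n with partial sums S_i, the red
cards contribute about ∏ S_i/(2n) and the blue ones about exp(-S_k²/(4n)) (`le_prob_pattern`).

With S_i = 2√n(x_1 + ⋯ + x_i), multiplying by the inverse cell volume (2√n)^k yields the density in
the limit (`tendsto_lowerBound`). Fatou's lemma integrates this pointwise bound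
(`limitLaw_le_liminf`). -/

noncomputable section

namespace MemoryGame

/-! ### Colour patterns in a uniform arrangement -/

/-- For a fixed-point free involution of `Fin N`, the points of `[t, N)` sent below `t`, together
with twice the points of `[0, t)` that are the larger element of their orbit, number `t`. -/
lemma card_crossing_add_two_mul {N : ℕ} (π : Fin N → Fin N) (hπ : Function.Involutive π)
    (hfix : ∀ p, π p ≠ p) (t : ℕ) (ht : t ≤ N) :
    (Finset.univ.filter fun s : Fin N => t ≤ s.val ∧ (π s).val < t).card +
      2 * (Finset.univ.filter fun z : Fin N => z.val < t ∧ π z < z).card = t := by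
  have h1 : (Finset.univ.filter fun s : Fin N => t ≤ s.val ∧ (π s).val < t).card =
      (Finset.univ.filter fun s : Fin N => s.val < t ∧ t ≤ (π s).val).card := by
    refine Finset.card_bij' (fun s _ => π s) (fun s _ => π s) ?_ ?_ ?_ ?_ <;>
      simp +contextual [hπ _]
  have h2 : (Finset.univ.filter fun z : Fin N => z.val < t ∧ π z < z).card =
      (Finset.univ.filter fun z : Fin N => z < π z ∧ (π z).val < t).card := by
    refine Finset.card_bij' (fun s _ => π s) (fun s _ => π s) ?_ ?_ ?_ ?_ <;>
      simp +contextual [hπ _]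
  have h3 : (Finset.univ.filter fun z : Fin N => z.val < t).card = t := by
    simp [Fin.card_filter_val_lt, ht]
  have hd : Disjoint (Finset.univ.filter fun z : Fin N => z.val < t ∧ π z < z)
      (Finset.univ.filter fun z : Fin N => z < π z ∧ (π z).val < t) := by
    rw [Finset.disjoint_filter]
    rintro z - ⟨_, h⟩ ⟨h', _⟩
    exact lt_asymm h h'
  have hd' : Disjoint (Finset.univ.filter fun s : Fin N => s.val < t ∧ t ≤ (π s).val)
      ((Finset.univ.filter fun z : Fin N => z.val < t ∧ π z < z) ∪
      (Finset.univ.filter fun z : Fin N => z < π z ∧ (π z).val < t)) := by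
    rw [← Finset.filter_or, Finset.disjoint_filter]
    rintro z - ⟨h, h'⟩ (⟨_, h3⟩ | ⟨_, h3⟩)
    · rw [Fin.lt_def] at h3; omega
    · omega
  -- A point below `t` is paired across `t`, or is the larger or the smaller element of a pair lying
  -- below `t`.
  have hu : (Finset.univ.filter fun s : Fin N => s.val < t ∧ t ≤ (π s).val) ∪
      ((Finset.univ.filter fun z : Fin N => z.val < t ∧ π z < z) ∪
      (Finset.univ.filter fun z : Fin N => z < π z ∧ (π z).val < t)) =
      (Finset.univ.filter fun z : Fin N => z.val < t) := by
    ext z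
    have := hfix z
    simp only [Finset.mem_union, Finset.mem_filter, Finset.mem_univ, true_and, Fin.lt_def]
    rw [Ne, Fin.ext_iff] at this
    omega
  rw [← hu, Finset.card_union_of_disjoint hd', Finset.card_union_of_disjoint hd] at h3
  omega

/-- The card with the same label and the other colour. -/
def otherCard {n : ℕ} (x : Card n) : Card n := (x.1, !x.2)

/-- In an arrangement of the `2n` cards, the position of the other card of the pair found
at position `p`. -/
def mate {n : ℕ} (σ : Fin (2 * n) ≃ Card n) (p : Fin (2 * n)) : Fin (2 * n) :=
  σ.symm (otherCard (σ p))

lemma mate_involutive {n : ℕ} (σ : Fin (2 * n) ≃ Card n) : Function.Involutive (mate σ) := by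
  intro p
  simp [mate, otherCard]

lemma mate_ne {n : ℕ} (σ : Fin (2 * n) ≃ Card n) (p : Fin (2 * n)) : mate σ p ≠ p := by
  intro h
  have := congrArg (fun q => (σ q).2) h
  simp [mate, otherCard] at this

open Classical in
/-- The arrangements of the cards such that, among the first `t` positions, exactly those in `c`
hold the second card of their pair. -/
def prefixSet (n : ℕ) (c : ℕ → Prop) (t : ℕ) : Finset (Fin (2 * n) ≃ Card n) :=
  Finset.univ.filter fun σ => ∀ p : Fin (2 * n), p.val < t → (mate σ p < p ↔ c p.val)

lemma mem_prefixSet {n : ℕ} {c : ℕ → Prop} {t : ℕ} {σ : Fin (2 * n) ≃ Card n} :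
    σ ∈ prefixSet n c t ↔ ∀ p : Fin (2 * n), p.val < t → (mate σ p < p ↔ c p.val) := by
  simp [prefixSet]

lemma mate_swap {n : ℕ} (σ : Fin (2 * n) ≃ Card n) (a b p : Fin (2 * n)) :
    mate ((Equiv.swap a b).trans σ) p = Equiv.swap a b (mate σ (Equiv.swap a b p)) := by
  simp [mate]

lemma swap_val_lt_iff {N : ℕ} {a b z : Fin N} {m : ℕ} (ha : m ≤ a.val) (hb : m ≤ b.val) :
    (Equiv.swap a b z).val < m ↔ z.val < m := by
  rcases eq_or_ne z a with rfl | h1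
  · rw [Equiv.swap_apply_left]; omega
  rcases eq_or_ne z b with rfl | h2
  · rw [Equiv.swap_apply_right]; omega
  rw [Equiv.swap_apply_of_ne_of_ne h1 h2]

/-- A swap beyond `t` fixes each `p < t` and cannot move its mate across `p`. -/
lemma swap_trans_mem_prefixSet {n : ℕ} {c : ℕ → Prop} {t : ℕ} {σ : Fin (2 * n) ≃ Card n}
    {a b : Fin (2 * n)} (ha : t ≤ a.val) (hb : t ≤ b.val) (h : σ ∈ prefixSet n c t) :
    (Equiv.swap a b).trans σ ∈ prefixSet n c t := by
  rw [mem_prefixSet] at h ⊢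
  intro p hp
  have hpa : p ≠ a := by rintro rfl; omega
  have hpb : p ≠ b := by rintro rfl; omega
  rw [← h p hp, mate_swap, Equiv.swap_apply_of_ne_of_ne hpa hpb, Fin.lt_def, Fin.lt_def,
    swap_val_lt_iff (by omega) (by omega)]

lemma card_mate_lt_eq {n : ℕ} (c : ℕ → Prop) {t : ℕ} (a b : Fin (2 * n)) (ha : t ≤ a.val)
    (hb : t ≤ b.val) :
    ((prefixSet n c t).filter fun σ => (mate σ a).val < t).card =
      ((prefixSet n c t).filter fun σ => (mate σ b).val < t).card := by
  refine Finset.card_bij' (fun σ _ => (Equiv.swap a b).trans σ)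
    (fun σ _ => (Equiv.swap a b).trans σ) ?_ ?_ ?_ ?_
  · intro σ hσ
    rw [Finset.mem_filter] at hσ ⊢
    refine ⟨swap_trans_mem_prefixSet ha hb hσ.1, ?_⟩
    rw [mate_swap, swap_val_lt_iff ha hb, Equiv.swap_apply_right]
    exact hσ.2
  · intro σ hσ
    rw [Finset.mem_filter] at hσ ⊢
    refine ⟨swap_trans_mem_prefixSet ha hb hσ.1, ?_⟩
    rw [mate_swap, swap_val_lt_iff ha hb, Equiv.swap_apply_left]
    exact hσ.2
  · intro σ _
    ext p <;> simp
  · intro σ _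
    ext p <;> simp

lemma card_filter_mate_lt_self {n : ℕ} {c : ℕ → Prop} [DecidablePred c] {t : ℕ} (ht : t ≤ 2 * n)
    {σ : Fin (2 * n) ≃ Card n} (hσ : σ ∈ prefixSet n c t) :
    (Finset.univ.filter fun z : Fin (2 * n) => z.val < t ∧ mate σ z < z).card =
      ((Finset.range t).filter c).card := by
  rw [mem_prefixSet] at hσ
  refine Finset.card_bij (fun z _ => z.val) ?_ ?_ ?_
  · intro z hz
    simp only [Finset.mem_filter, Finset.mem_univ, true_and, Finset.mem_range] at hz ⊢
    exact ⟨hz.1, (hσ z hz.1).1 hz.2⟩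
  · intro a _ b _ h
    exact Fin.ext h
  · intro p hp
    simp only [Finset.mem_filter, Finset.mem_range] at hp
    refine ⟨⟨p, by omega⟩, ?_, rfl⟩
    simp only [Finset.mem_filter, Finset.mem_univ, true_and]
    exact ⟨hp.1, (hσ ⟨p, by omega⟩ hp.1).2 hp.2⟩

/-- By exchangeability of the positions from `t` on, the second card of a pair that was opened
in the first `t` positions is equally likely to be at any of them. -/
lemma card_mate_lt_mul {n : ℕ} (c : ℕ → Prop) [DecidablePred c] {t : ℕ} (ht : t < 2 * n) :
    (((prefixSet n c t).filter fun σ => (mate σ ⟨t, ht⟩).val < t).card : ℝ) * (2 * n - t) =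
      (prefixSet n c t).card * (t - 2 * ((Finset.range t).filter c).card) := by
  set A := prefixSet n c t
  -- Double counting of the pairs (s, σ) with `t ≤ s` whose mate lies below `t`: all `s` contribute
  -- equally, and every σ has the same number of open pairs.
  have h1 : ∑ s ∈ Finset.univ.filter (fun s : Fin (2 * n) => t ≤ s.val),
      (A.filter fun σ => (mate σ s).val < t).card =
      (2 * n - t) * (A.filter fun σ => (mate σ ⟨t, ht⟩).val < t).card := by
    rw [Finset.sum_congr rfl fun s hs =>
      card_mate_lt_eq c s ⟨t, ht⟩ (by simpa using hs) le_rfl, Finset.sum_const, smul_eq_mul]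
    congr 1
    have := Finset.card_filter_add_card_filter_not (s := (Finset.univ : Finset (Fin (2 * n))))
      (fun s => s.val < t)
    simp only [Fin.card_filter_val_lt, not_lt, Finset.card_univ, Fintype.card_fin] at this
    omega
  have h2 : ∑ s ∈ Finset.univ.filter (fun s : Fin (2 * n) => t ≤ s.val),
      (A.filter fun σ => (mate σ s).val < t).card =
      ∑ σ ∈ A, (Finset.univ.filter fun s : Fin (2 * n) => t ≤ s.val ∧ (mate σ s).val < t).card := by
    simp_rw [Finset.card_filter]
    rw [Finset.sum_comm]
    refine Finset.sum_congr rfl fun σ _ => ?_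
    rw [Finset.sum_filter]
    simp [ite_and]
  have h3 : ∀ σ ∈ A, ((Finset.univ.filter fun s : Fin (2 * n) =>
      t ≤ s.val ∧ (mate σ s).val < t).card : ℝ) = t - 2 * ((Finset.range t).filter c).card := by
    intro σ hσ
    have := card_crossing_add_two_mul (mate σ) (mate_involutive σ) (mate_ne σ) t ht.le
    rw [card_filter_mate_lt_self ht.le hσ] at this
    rw [eq_sub_iff_add_eq]
    exact_mod_cast this
  have h4 := h1.symm.trans h2
  have h5 := congrArg (Nat.cast : ℕ → ℝ) h4
  push_cast [Nat.cast_sub ht.le] at h5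
  rw [Finset.sum_congr rfl h3, Finset.sum_const, nsmul_eq_mul] at h5
  rw [← h5]; ring

/-- With r earlier second cards, t - 2r of the 2n - t remaining cards close an open pair; the other
2n - 2(t - r) belong to unopened pairs. -/
lemma card_prefixSet_succ {n : ℕ} (c : ℕ → Prop) [DecidablePred c] {t : ℕ} (ht : t < 2 * n) :
    ((prefixSet n c (t + 1)).card : ℝ) * (2 * n - t) =
      (prefixSet n c t).card * if c t then (t - 2 * ((Finset.range t).filter c).card : ℝ)
        else 2 * n - 2 * (t - ((Finset.range t).filter c).card) := by
  have key := card_mate_lt_mul c ht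
  have hmem : ∀ σ, σ ∈ prefixSet n c (t + 1) ↔
      σ ∈ prefixSet n c t ∧ ((mate σ ⟨t, ht⟩).val < t ↔ c t) := by
    intro σ
    simp only [mem_prefixSet]
    constructor
    · intro h
      exact ⟨fun p hp => h p (by omega), h ⟨t, ht⟩ (by simp)⟩
    · rintro ⟨h, h'⟩ p hp
      rcases Nat.lt_succ_iff_lt_or_eq.1 hp with h1 | h1
      · exact h p h1
      · obtain rfl : p = ⟨t, ht⟩ := Fin.ext h1
        exact h'
  split_ifs with hc
  · rw [← key]
    congr 3
    ext σ
    simp [hmem, hc]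
  · have h1 : prefixSet n c (t + 1) =
        (prefixSet n c t).filter fun σ => ¬ (mate σ ⟨t, ht⟩).val < t := by
      ext σ
      simp [hmem, hc]
    have h2 := Finset.card_filter_add_card_filter_not (s := prefixSet n c t)
      (fun σ => (mate σ ⟨t, ht⟩).val < t)
    rw [← h1] at h2
    have h3 := congrArg (Nat.cast : ℕ → ℝ) h2
    push_cast at h3
    linear_combination (2 * (n : ℝ) - t) * h3 - key

/-- The probability of a given colour pattern on the first `t` positions. -/
lemma card_prefixSet {n : ℕ} (c : ℕ → Prop) [DecidablePred c] {t : ℕ} (ht : t ≤ 2 * n) :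
    ((prefixSet n c t).card : ℝ) = Fintype.card (Fin (2 * n) ≃ Card n) *
      ∏ p ∈ Finset.range t, (if c p then (p - 2 * ((Finset.range p).filter c).card : ℝ)
        else 2 * n - 2 * (p - ((Finset.range p).filter c).card)) / (2 * n - p) := by
  induction t with
  | zero => simp [prefixSet]
  | succ t ih =>
    have h0 : (t : ℝ) < 2 * n := by exact_mod_cast (by omega : t < 2 * n)
    have h1 : (2 * n - t : ℝ) ≠ 0 := by linarith
    rw [Finset.prod_range_succ, ← mul_assoc, ← ih (by omega), ← mul_div_assoc,
      ← card_prefixSet_succ c (by omega), mul_div_cancel_right₀ _ h1]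

/-! ### From arrangements to games -/

/-- Exchange the colours within the pairs selected by `ε`. -/
def recolour {n : ℕ} (ε : Fin n → Bool) : Card n ≃ Card n :=
  Function.Involutive.toPerm (fun x => (x.1, xor x.2 (ε x.1))) fun x => by simp

lemma recolour_apply {n : ℕ} (ε : Fin n → Bool) (x : Card n) :
    recolour ε x = (x.1, xor x.2 (ε x.1)) := rfl

lemma mate_recolour {n : ℕ} (σ : Fin (2 * n) ≃ Card n) (ε : Fin n → Bool) :
    mate (σ.trans (recolour ε)) = mate σ := by
  funext p
  have h : (recolour ε).symm (otherCard (recolour ε (σ p))) = otherCard (σ p) := by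
    rw [Equiv.symm_apply_eq]
    simp [recolour_apply, otherCard]
  simp [mate, h]

/-- This replaces colour by a condition on mates, which recolouring does not change. -/
lemma isRed_iff {n : ℕ} (σ : Deal n) (p : Fin (2 * n)) : σ.IsRed p ↔ mate σ.1 p < p := by
  obtain ⟨σ, hσ⟩ := σ
  obtain ⟨⟨a, b⟩, rfl⟩ := σ.symm.surjective p
  cases b
  · simpa [Deal.IsRed, mate, otherCard] using (hσ a).le
  · simpa [Deal.IsRed, mate, otherCard] using hσ a

lemma recolour_symm_apply {n : ℕ} (ε : Fin n → Bool) (x : Card n) :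
    (recolour ε).symm x = (x.1, xor x.2 (ε x.1)) := rfl

/-- Every arrangement of the cards is obtained in exactly one way from a game by recolouring. -/
lemma bijective_recolour (n : ℕ) :
    Function.Bijective fun x : Deal n × (Fin n → Bool) => x.1.1.trans (recolour x.2) := by
  constructor
  · rintro ⟨σ, ε⟩ ⟨τ, δ⟩ h
    simp only at h
    have hs : ∀ x, σ.1.symm ((recolour ε).symm x) = τ.1.symm ((recolour δ).symm x) := fun x => by
      simpa using congrArg (fun e : Fin (2 * n) ≃ Card n => e.symm x) h
    -- If ε and δ differed at a label, the two games would have its cards in opposite orders.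
    have hε : ε = δ := by
      funext a
      have h1 := hs (a, true)
      have h2 := hs (a, false)
      have h3 := σ.2 a
      have h4 := τ.2 a
      simp only [recolour_symm_apply] at h1 h2
      cases hε : ε a <;> cases hδ : δ a <;> simp only [hε, hδ, Bool.xor_false, Bool.xor_true,
        Bool.not_true, Bool.not_false] at h1 h2 ⊢
      · rw [h1, h2] at h3; exact absurd h3 h4.asymm
      · rw [h1, h2] at h3; exact absurd h3 h4.asymm
    subst hε
    refine Prod.ext (Subtype.ext ?_) rfl
    apply Equiv.ext
    intro p
    have := congrArg (fun e : Fin (2 * n) ≃ Card n => e p) h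
    simpa using this
  · intro τ
    let ε : Fin n → Bool := fun a => decide (τ.symm (a, true) < τ.symm (a, false))
    refine ⟨⟨⟨τ.trans (recolour ε), fun a => ?_⟩, ε⟩, ?_⟩
    · have hne : τ.symm (a, false) ≠ τ.symm (a, true) := by simp
      simp only [Equiv.symm_trans_apply, recolour_symm_apply]
      by_cases h : τ.symm (a, true) < τ.symm (a, false)
      · simp [ε, h]
      · have h' := lt_of_le_of_ne (not_lt.1 h) hne
        simpa [ε, h'.not_gt] using h'
    · apply Equiv.ext
      intro p
      simp [recolour, Function.Involutive.toPerm]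

/-- A uniformly random game and a uniformly random arrangement give the same probability to
a colour pattern of the first `t` positions. -/
lemma card_filter_isRed_mul {n : ℕ} (c : ℕ → Prop) (t : ℕ) [DecidablePred fun σ : Deal n =>
      ∀ p : Fin (2 * n), p.val < t → (σ.IsRed p ↔ c p.val)] :
    (Finset.univ.filter fun σ : Deal n =>
      ∀ p : Fin (2 * n), p.val < t → (σ.IsRed p ↔ c p.val)).card *
        Fintype.card (Fin (2 * n) ≃ Card n) =
      (prefixSet n c t).card * Fintype.card (Deal n) := by
  have h1 : Fintype.card (Fin (2 * n) ≃ Card n) = Fintype.card (Deal n) * 2 ^ n := by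
    rw [← Fintype.card_of_bijective (bijective_recolour n)]
    simp
  have h2 : (prefixSet n c t).card = (Finset.univ.filter fun σ : Deal n =>
      ∀ p : Fin (2 * n), p.val < t → (σ.IsRed p ↔ c p.val)).card * 2 ^ n := by
    have h3 : (2 : ℕ) ^ n = (Finset.univ : Finset (Fin n → Bool)).card := by simp
    rw [h3, ← Finset.card_product]
    symm
    refine Finset.card_bij (fun x _ => x.1.1.trans (recolour x.2)) ?_ ?_ ?_
    · intro x hx
      rw [mem_prefixSet, mate_recolour]
      simpa [isRed_iff] using hx
    · intro x _ y _ h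
      exact (bijective_recolour n).1 h
    · intro τ hτ
      obtain ⟨x, hx⟩ := (bijective_recolour n).2 τ
      refine ⟨x, ?_, hx⟩
      rw [mem_prefixSet, ← hx, mate_recolour] at hτ
      simpa [isRed_iff] using hτ
  rw [h1, h2]; ring

/-! ### Block lengths as colour patterns -/

/-- The total length of the first `i` blocks when the block lengths are `d`. -/
def partialSum (d : ℕ → ℕ) (i : ℕ) : ℕ := ∑ j ∈ Finset.range i, d j

/-- Among the positions, those that hold the first `k` red cards when the block lengths
are `d`. -/
def IsBlockEnd (d : ℕ → ℕ) (k p : ℕ) : Prop := ∃ i < k, partialSum d (i + 1) = p + 1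

lemma partialSum_strictMono {d : ℕ → ℕ} (hd : ∀ i, 0 < d i) : StrictMono (partialSum d) :=
  strictMono_nat_of_lt_succ fun i => by
    rw [partialSum, partialSum, Finset.sum_range_succ]
    exact Nat.lt_add_of_pos_right (hd i)

lemma partialSum_succ_pos {d : ℕ → ℕ} (hd : ∀ i, 0 < d i) (i : ℕ) : 0 < partialSum d (i + 1) :=
  (Nat.zero_le _).trans_lt (partialSum_strictMono hd i.lt_succ_self)

open Classical in
-- Block `i` ends at position `partialSum d (i + 1) - 1`, so strict monotonicity of partial sums
-- identifies the ends before `p`.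
lemma filter_isBlockEnd {d : ℕ → ℕ} (hd : ∀ i, 0 < d i) {k j p : ℕ} (hjk : j ≤ k)
    (h1 : partialSum d j ≤ p) (h2 : p < partialSum d (j + 1)) :
    (Finset.range p).filter (IsBlockEnd d k) =
      (Finset.range j).image fun i => partialSum d (i + 1) - 1 := by
  have hS := partialSum_strictMono hd
  ext q
  simp only [Finset.mem_filter, Finset.mem_range, Finset.mem_image]
  constructor
  · rintro ⟨hq, i, hi, hiq⟩
    refine ⟨i, ?_, by omega⟩
    have : partialSum d (i + 1) < partialSum d (j + 1) := by omega
    have := hS.lt_iff_lt.1 this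
    omega
  · rintro ⟨i, hi, rfl⟩
    have h3 := partialSum_succ_pos hd i
    have h4 : partialSum d (i + 1) ≤ partialSum d j := hS.monotone hi
    exact ⟨by omega, i, by omega, by omega⟩

lemma injOn_blockEnd {d : ℕ → ℕ} (hd : ∀ i, 0 < d i) (s : Set ℕ) :
    Set.InjOn (fun i => partialSum d (i + 1) - 1) s := by
  intro a _ b _ h
  have h1 := partialSum_succ_pos hd a
  have h2 := partialSum_succ_pos hd b
  have := (partialSum_strictMono hd).injective (a₁ := a + 1) (a₂ := b + 1) (by simp only at h; omega)
  omega

/-- If the red cards among the first positions are at the ends of blocks of lengths `d`, then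
the block lengths of the game are `d`. -/
lemma blockLength_eq {d : ℕ → ℕ} (hd : ∀ i, 0 < d i) {n k : ℕ} (hk : partialSum d k ≤ 2 * n)
    {σ : Deal n}
    (hσ : ∀ p : Fin (2 * n), p.val < partialSum d k → (σ.IsRed p ↔ IsBlockEnd d k p.val))
    {i : ℕ} (hi : i < k) : σ.blockLength i = d i := by
  have hS := partialSum_strictMono hd
  have hlow : ∀ j ≤ k, ∀ p : Fin (2 * n), partialSum d j ≤ p.val →
      j ≤ (Finset.univ.filter fun q => q < p ∧ σ.IsRed q).card := by
    intro j hj p hp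
    have hjk := hS.monotone hj
    rw [← Finset.card_range j, ← Finset.card_image_of_injOn (injOn_blockEnd hd (Finset.range j)),
      ← Finset.card_map Fin.valEmbedding (s := Finset.univ.filter fun q => q < p ∧ σ.IsRed q)]
    refine Finset.card_le_card fun q hq => ?_
    simp only [Finset.mem_image, Finset.mem_range] at hq
    obtain ⟨a, ha, rfl⟩ := hq
    have h3 := partialSum_succ_pos hd a
    have h4 : partialSum d (a + 1) ≤ partialSum d j := hS.monotone ha
    simp only [Finset.mem_map, Finset.mem_filter, Finset.mem_univ, true_and, Fin.valEmbedding_apply]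
    refine ⟨⟨partialSum d (a + 1) - 1, by omega⟩, ⟨?_, ?_⟩, rfl⟩
    · rw [Fin.lt_def]; simp only; omega
    · rw [hσ _ (by simp only; omega)]
      exact ⟨a, by omega, by simp only; omega⟩
  have hupp : ∀ j < k, ∀ p : Fin (2 * n), p.val < partialSum d (j + 1) →
      (Finset.univ.filter fun q => q < p ∧ σ.IsRed q).card ≤ j := by
    intro j hj p hp
    have hjk : partialSum d (j + 1) ≤ partialSum d k := hS.monotone hj
    rw [← Finset.card_map Fin.valEmbedding]
    refine le_trans (Finset.card_le_card (t := (Finset.range j).image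
      fun i => partialSum d (i + 1) - 1) fun q hq => ?_)
      (Finset.card_image_le.trans (Finset.card_range j).le)
    simp only [Finset.mem_map, Finset.mem_filter, Finset.mem_univ, true_and,
      Fin.valEmbedding_apply] at hq
    obtain ⟨q, ⟨hqp, hred⟩, rfl⟩ := hq
    rw [Fin.lt_def] at hqp
    rw [hσ q (by omega)] at hred
    obtain ⟨a, ha, haq⟩ := hred
    have := hS.lt_iff_lt.1 (show partialSum d (a + 1) < partialSum d (j + 1) by omega)
    simp only [Finset.mem_image, Finset.mem_range]
    exact ⟨a, by omega, by omega⟩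
  have hik : partialSum d (i + 1) ≤ partialSum d k := hS.monotone hi
  have hblock : (σ.block i).map Fin.valEmbedding =
      Finset.Ico (partialSum d i) (partialSum d (i + 1)) := by
    ext p
    simp only [Deal.block, Finset.mem_map, Finset.mem_filter, Finset.mem_univ, true_and,
      Fin.valEmbedding_apply, Finset.mem_Ico]
    constructor
    · rintro ⟨p, hp, rfl⟩
      constructor
      · by_contra! h
        rcases i with _ | i
        · simp [partialSum] at h
        · have := hupp i (by omega) p h
          omega
      · by_contra! h
        have := hlow (i + 1) hi p h
        omega
    · rintro ⟨h1, h2⟩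
      refine ⟨⟨p, by omega⟩, ?_, rfl⟩
      exact le_antisymm (hupp i hi _ h2) (hlow i hi.le _ h1)
  rw [Deal.blockLength, ← Finset.card_map Fin.valEmbedding, hblock, Nat.card_Ico, partialSum,
    partialSum, Finset.sum_range_succ, Nat.add_sub_cancel_left]

/-! ### Lower bound for the joint mass function -/

/-- Dropping `r` lowers the fraction; the reciprocal is then 1 + p/(2n - 2p), at most exp(p/(2n -
2t)). -/
lemma exp_neg_le_blue {n p t r : ℝ} (hp : 0 ≤ p) (hpt : p ≤ t) (htn : t < n) (hr : 0 ≤ r) :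
    Real.exp (-(p / (2 * n - 2 * t))) ≤ (2 * n - 2 * (p - r)) / (2 * n - p) := by
  have h1 : 0 < 2 * n - 2 * p := by linarith
  have h2 : 0 < 2 * n - 2 * t := by linarith
  have h3 : 0 < 2 * n - p := by linarith
  have h4 : (2 * n - p) / (2 * n - 2 * p) ≤ Real.exp (p / (2 * n - 2 * t)) := by
    have h5 : (2 * n - p) / (2 * n - 2 * p) = p / (2 * n - 2 * p) + 1 := by
      rw [eq_comm, div_add_one h1.ne']
      congr 1
      ring
    rw [h5]
    refine le_trans ?_ (Real.add_one_le_exp _)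
    gcongr
  rw [Real.exp_neg]
  calc (Real.exp (p / (2 * n - 2 * t)))⁻¹ ≤ ((2 * n - p) / (2 * n - 2 * p))⁻¹ := by gcongr
    _ = (2 * n - 2 * p) / (2 * n - p) := inv_div _ _
    _ ≤ _ := by gcongr; linarith

open Classical in
/-- A lower bound for the probability of given lengths of the first `k` blocks. -/
lemma le_prob_pattern {d : ℕ → ℕ} (hd : ∀ i, 2 ≤ d i) {n k : ℕ} (hn : partialSum d k < n) :
    (∏ i ∈ Finset.range k, ((partialSum d (i + 1) : ℝ) - 1 - 2 * i) / (2 * n)) *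
        Real.exp (-((partialSum d k : ℝ) ^ 2 / (4 * (n - partialSum d k)))) ≤
      ∏ p ∈ Finset.range (partialSum d k), (if IsBlockEnd d k p then
          (p - 2 * ((Finset.range p).filter (IsBlockEnd d k)).card : ℝ)
        else 2 * n - 2 * (p - ((Finset.range p).filter (IsBlockEnd d k)).card)) / (2 * n - p) := by
  have hd0 : ∀ i, 0 < d i := fun i => by have := hd i; omega
  have hS := partialSum_strictMono hd0
  set t := partialSum d k with ht
  have htn : (t : ℝ) < n := by exact_mod_cast hn
  have hn0 : (0 : ℝ) < n := (Nat.cast_nonneg t).trans_lt htn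
  have hred : ∀ i < k, ((((Finset.range (partialSum d (i + 1) - 1)).filter
      (IsBlockEnd d k)).card : ℕ) : ℝ) = i ∧ 2 * (i : ℝ) ≤ (partialSum d (i + 1) - 1 : ℕ) ∧
      ((partialSum d (i + 1) - 1 : ℕ) : ℝ) = (partialSum d (i + 1) : ℝ) - 1 := by
    intro i hi
    have h1 := partialSum_succ_pos hd0 i
    have h2 : partialSum d i < partialSum d (i + 1) := hS i.lt_succ_self
    rw [filter_isBlockEnd hd0 hi.le (by omega) (by omega),
      Finset.card_image_of_injOn (injOn_blockEnd hd0 _), Finset.card_range]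
    refine ⟨rfl, ?_, by push_cast [Nat.cast_sub (show 1 ≤ _ from h1)]; rfl⟩
    -- Blocks of length at least two keep the red factors nonnegative.
    have h3 : (i + 1) * 2 ≤ partialSum d (i + 1) := by
      have := Finset.card_nsmul_le_sum (Finset.range (i + 1)) d 2 fun j _ => hd j
      simpa [partialSum] using this
    exact_mod_cast (by omega : 2 * i ≤ partialSum d (i + 1) - 1)
  -- Padding with ones at the blue positions allows a comparison factor by factor.
  have hprod : ∏ i ∈ Finset.range k, ((partialSum d (i + 1) : ℝ) - 1 - 2 * i) / (2 * n) =
      ∏ p ∈ Finset.range t, if IsBlockEnd d k p then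
        (p - 2 * ((Finset.range p).filter (IsBlockEnd d k)).card : ℝ) / (2 * n) else 1 := by
    rw [← Finset.prod_filter, filter_isBlockEnd hd0 le_rfl le_rfl (hS k.lt_succ_self),
      Finset.prod_image (injOn_blockEnd hd0 _)]
    refine Finset.prod_congr rfl fun i hi => ?_
    obtain ⟨h1, h2, h3⟩ := hred i (Finset.mem_range.1 hi)
    rw [h1, h3]
  have hexp : Real.exp (-((t : ℝ) ^ 2 / (4 * (n - t)))) ≤
      ∏ p ∈ Finset.range t, Real.exp (-((p : ℝ) / (2 * n - 2 * t))) := by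
    rw [← Real.exp_sum, Finset.sum_neg_distrib, ← Finset.sum_div]
    have h1 : (∑ p ∈ Finset.range t, (p : ℝ)) * 2 ≤ (t : ℝ) ^ 2 := by
      have := Finset.sum_range_id_mul_two t
      have h2 : (∑ p ∈ Finset.range t, p) * 2 ≤ t ^ 2 := by
        rw [this, sq]; exact Nat.mul_le_mul_left _ (Nat.sub_le _ _)
      have h3 := (Nat.cast_le (α := ℝ)).2 h2
      push_cast at h3
      exact h3
    rw [Real.exp_le_exp, neg_le_neg_iff]
    have h0 : 0 < (n : ℝ) - t := by linarith
    rw [div_le_div_iff₀ (by linarith) (by linarith)]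
    nlinarith
  have hpos : ∀ p ∈ Finset.range t, (0 : ℝ) ≤ if IsBlockEnd d k p then
        (p - 2 * ((Finset.range p).filter (IsBlockEnd d k)).card : ℝ) / (2 * n) else 1 := by
    intro p hp
    split_ifs with h
    · obtain ⟨i, hi, hip⟩ := h
      obtain ⟨h1, h2, h3⟩ := hred i hi
      obtain rfl : p = partialSum d (i + 1) - 1 := by omega
      rw [h1]
      apply div_nonneg <;> linarith
    · exact zero_le_one
  calc _ ≤ (∏ p ∈ Finset.range t, if IsBlockEnd d k p then
        (p - 2 * ((Finset.range p).filter (IsBlockEnd d k)).card : ℝ) / (2 * n) else 1) *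
        ∏ p ∈ Finset.range t, Real.exp (-((p : ℝ) / (2 * n - 2 * t))) := by
        rw [hprod]
        exact mul_le_mul_of_nonneg_left hexp (Finset.prod_nonneg hpos)
    _ ≤ _ := by
      rw [← Finset.prod_mul_distrib]
      refine Finset.prod_le_prod
        (fun p hp => mul_nonneg (hpos p hp) (Real.exp_pos _).le) fun p hp => ?_
      have hpt : (p : ℝ) < t := by exact_mod_cast Finset.mem_range.1 hp
      have h0 := hpos p hp
      split_ifs at h0 ⊢ with h
      · have h1 : Real.exp (-((p : ℝ) / (2 * n - 2 * t))) ≤ 1 := by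
          rw [Real.exp_le_one_iff, neg_nonpos]
          exact div_nonneg (Nat.cast_nonneg p) (by linarith)
        refine (mul_le_of_le_one_right h0 h1).trans ?_
        have h2 : 0 ≤ (p - 2 * ((Finset.range p).filter (IsBlockEnd d k)).card : ℝ) := by
          simpa using (le_div_iff₀ (by linarith)).1 h0
        have h3 : (0 : ℝ) < 2 * n - p := by linarith
        have : (0 : ℝ) ≤ p := Nat.cast_nonneg p
        gcongr
        linarith
      · rw [one_mul]
        exact exp_neg_le_blue (Nat.cast_nonneg p) hpt.le htn (Nat.cast_nonneg _)

open Classical in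
/-- A lower bound for the joint probability mass function of the first `k` block lengths. -/
lemma le_randomGame_blockLength {d : ℕ → ℕ} (hd : ∀ i, 2 ≤ d i) {n k : ℕ}
    (hn : partialSum d k < n) :
    ENNReal.ofReal ((∏ i ∈ Finset.range k, ((partialSum d (i + 1) : ℝ) - 1 - 2 * i) / (2 * n)) *
        Real.exp (-((partialSum d k : ℝ) ^ 2 / (4 * (n - partialSum d k))))) ≤
      randomGame n {σ | ∀ i < k, σ.blockLength i = d i} := by
  have hd0 : ∀ i, 0 < d i := fun i => by have := hd i; omega
  set F := Finset.univ.filter fun σ : Deal n =>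
      ∀ p : Fin (2 * n), p.val < partialSum d k → (σ.IsRed p ↔ IsBlockEnd d k p.val) with hF
  have hsub : (F : Set (Deal n)) ⊆ {σ | ∀ i < k, σ.blockLength i = d i} := by
    intro σ hσ i hi
    rw [hF, Finset.coe_filter] at hσ
    exact blockLength_eq hd0 (by omega) hσ.2 hi
  have hcard : (0 : ℝ) < Fintype.card (Deal n) := by exact_mod_cast Fintype.card_pos
  have hX : (0 : ℝ) < Fintype.card (Fin (2 * n) ≃ Card n) := by
    have : Nonempty (Fin (2 * n) ≃ Card n) := ⟨(Classical.arbitrary (Deal n)).1⟩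
    exact_mod_cast Fintype.card_pos
  have hmeas : randomGame n F = ENNReal.ofReal ((F.card : ℝ) / Fintype.card (Deal n)) := by
    rw [randomGame, PMF.toMeasure_uniformOfFintype_apply _ (MeasurableSpace.measurableSet_top),
      ENNReal.ofReal_div_of_pos hcard]
    simp
  refine le_trans ?_ (measure_mono hsub)
  rw [hmeas]
  refine ENNReal.ofReal_le_ofReal ?_
  refine (le_prob_pattern hd hn).trans (le_of_eq ?_)
  have h1 := congrArg (Nat.cast : ℕ → ℝ)
    (card_filter_isRed_mul (n := n) (IsBlockEnd d k) (partialSum d k))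
  push_cast at h1
  rw [card_prefixSet (IsBlockEnd d k) (by omega)] at h1
  rw [eq_div_iff hcard.ne']
  refine mul_right_cancel₀ hX.ne' ?_
  rw [h1]
  ring

/-! ### Total mass of the limit density -/

lemma measurable_limitDensity (k : ℕ) : Measurable (limitDensity k) := by
  unfold limitDensity
  refine Measurable.ite ?_ (by fun_prop) measurable_const
  have : {x : Fin k → ℝ | ∀ i, 0 ≤ x i} = ⋂ i, {x | 0 ≤ x i} := by ext; simp
  rw [this]
  exact MeasurableSet.iInter fun i => measurableSet_le measurable_const (measurable_pi_apply i)

/-- The integrand has antiderivative -exp(-(a + x)²). -/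
lemma lintegral_shifted_rayleigh {a : ℝ} (ha : 0 ≤ a) :
    ∫⁻ x in Set.Ici 0, ENNReal.ofReal (2 * (a + x) * Real.exp (-(a + x) ^ 2)) =
      ENNReal.ofReal (Real.exp (-a ^ 2)) := by
  have hderiv : ∀ x ∈ Set.Ici (0 : ℝ), HasDerivAt (fun x => -Real.exp (-(a + x) ^ 2))
      (2 * (a + x) * Real.exp (-(a + x) ^ 2)) x := by
    intro x _
    have h := ((((hasDerivAt_id x).const_add a).pow 2).neg.exp).neg
    refine h.congr_deriv ?_
    simp only [Pi.pow_apply, id, Nat.cast_ofNat, Nat.add_one_sub_one, pow_one, mul_one, Pi.neg_apply]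
    ring
  have hpos : ∀ x ∈ Set.Ioi (0 : ℝ), 0 ≤ 2 * (a + x) * Real.exp (-(a + x) ^ 2) := by
    intro x hx
    have : (0 : ℝ) < x := hx
    positivity
  have hlim : Tendsto (fun x => -Real.exp (-(a + x) ^ 2)) atTop (nhds 0) := by
    rw [← neg_zero]
    refine (Real.tendsto_exp_atBot.comp (tendsto_neg_atTop_atBot.comp ?_)).neg
    exact (tendsto_pow_atTop two_ne_zero).comp (tendsto_atTop_add_const_left _ _ tendsto_id)
  rw [setLIntegral_congr Ioi_ae_eq_Ici.symm, ← ofReal_integral_eq_lintegral_ofReal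
    (integrableOn_Ioi_deriv_of_nonneg' hderiv hpos hlim)
    ((ae_restrict_iff' measurableSet_Ioi).2 (ae_of_all _ hpos)),
    integral_Ioi_of_hasDerivAt_of_nonneg' hderiv hpos hlim]
  simp

lemma limitDensity_snoc (k : ℕ) (y : Fin k → ℝ) (a : ℝ) :
    limitDensity (k + 1) (Fin.snoc y a) =
      if (∀ i, 0 ≤ y i) ∧ 0 ≤ a then (2 ^ k * ∏ i : Fin k, ∑ j ∈ Finset.Iic i, y j) *
        (2 * ((∑ j, y j) + a) * Real.exp (-((∑ j, y j) + a) ^ 2)) else 0 := by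
  have h1 : (∀ i, (0 : ℝ) ≤ (Fin.snoc y a : Fin (k + 1) → ℝ) i) ↔ (∀ i, 0 ≤ y i) ∧ 0 ≤ a := by
    rw [Fin.forall_fin_succ']
    simp
  have h2 : ∀ i : Fin k, ∑ j ∈ Finset.Iic i.castSucc, (Fin.snoc y a : Fin (k + 1) → ℝ) j =
      ∑ j ∈ Finset.Iic i, y j := by
    intro i
    rw [← Fin.map_castSuccEmb_Iic, Finset.sum_map]
    simp
  have h3 : Finset.Iic (Fin.last k) = Finset.univ := by
    ext j; simp [Fin.le_last]
  unfold limitDensity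
  simp only [h1, Fin.prod_univ_castSucc, h2, h3, Fin.sum_univ_castSucc, Fin.snoc_castSucc,
    Fin.snoc_last]
  split_ifs
  · ring
  · rfl

/-- Integrating out the last coordinate is a shifted Rayleigh integral and leaves the density in
dimension `k`, which drives the induction for the total mass. -/
lemma lintegral_limitDensity_snoc (k : ℕ) (y : Fin k → ℝ) :
    ∫⁻ a, ENNReal.ofReal (limitDensity (k + 1) (Fin.snoc y a)) =
      ENNReal.ofReal (limitDensity k y) := by
  by_cases hy : ∀ i, 0 ≤ y i
  · have hA : 0 ≤ 2 ^ k * ∏ i : Fin k, ∑ j ∈ Finset.Iic i, y j :=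
      mul_nonneg (by positivity)
        (Finset.prod_nonneg fun i _ => Finset.sum_nonneg fun j _ => hy j)
    have h1 : (fun a => ENNReal.ofReal (limitDensity (k + 1) (Fin.snoc y a))) =
        (Set.Ici 0).indicator fun a => ENNReal.ofReal (2 ^ k * ∏ i : Fin k, ∑ j ∈ Finset.Iic i, y j) *
          ENNReal.ofReal (2 * ((∑ j, y j) + a) * Real.exp (-((∑ j, y j) + a) ^ 2)) := by
      funext a
      rw [limitDensity_snoc, Set.indicator_apply]
      by_cases ha : 0 ≤ a
      · simp only [hy, implies_true, ha, and_self, if_true, Set.mem_Ici]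
        rw [ENNReal.ofReal_mul hA]
      · simp [ha]
    rw [h1, lintegral_indicator measurableSet_Ici, lintegral_const_mul _ (by fun_prop),
      lintegral_shifted_rayleigh (Finset.sum_nonneg fun j _ => hy j), ← ENNReal.ofReal_mul hA]
    simp only [limitDensity]
    rw [if_pos hy]
  · have h1 : ∀ a, limitDensity (k + 1) (Fin.snoc y a) = 0 := fun a => by
      rw [limitDensity_snoc, if_neg fun h => hy h.1]
    have h2 : limitDensity k y = 0 := if_neg hy
    simp [h1, h2]

lemma lintegral_limitDensity (k : ℕ) : ∫⁻ x, ENNReal.ofReal (limitDensity k x) = 1 := by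
  induction k with
  | zero =>
    rw [volume_pi, Measure.pi_of_empty (x := isEmptyElim), lintegral_dirac]
    simp [limitDensity]
  | succ k ih =>
    have hm := (measurable_limitDensity (k + 1)).ennreal_ofReal
    have he := (volume_preserving_piFinSuccAbove (fun _ : Fin (k + 1) => ℝ) (Fin.last k)).symm
    rw [← he.lintegral_comp_emb (MeasurableEquiv.measurableEmbedding _), Measure.volume_eq_prod,
      lintegral_prod_symm' (fun z => ENNReal.ofReal (limitDensity (k + 1)
        ((MeasurableEquiv.piFinSuccAbove (fun _ => ℝ) (Fin.last k)).symm z)))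
        (hm.comp (MeasurableEquiv.measurable _)), ← ih]
    refine lintegral_congr fun y => ?_
    rw [← lintegral_limitDensity_snoc]
    refine lintegral_congr fun a => ?_
    congr 2
    exact Fin.insertNth_last' a y

lemma isProbabilityMeasure_limitLaw (k : ℕ) : IsProbabilityMeasure (limitLaw k) :=
  ⟨by rw [limitLaw, withDensity_apply _ MeasurableSet.univ, Measure.restrict_univ,
    lintegral_limitDensity]⟩

/-! ### Spreading the mass function over lattice cells -/

/-- The pairs of a point of the orthant and a game such that the block lengths of the game are
given by the cell of the lattice `(2√n)⁻¹ ℤᵏ` containing the point, and the scaled block lengths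
are in `G`. -/
def cellSet (k n : ℕ) (G : Set (Fin k → ℝ)) : Set ((Fin k → ℝ) × Deal n) :=
  {z | (∀ i, 0 ≤ z.1 i) ∧ scaledBlockLengths k n z.2 ∈ G ∧
    ∀ i : Fin k, z.2.blockLength i = ⌊2 * √(n : ℝ) * z.1 i⌋₊ + 2}

lemma measurable_of_deal {n : ℕ} {α : Type*} [MeasurableSpace α] (f : Deal n → α) :
    Measurable f := measurable_from_top

lemma measurableSet_cellSet (k n : ℕ) {G : Set (Fin k → ℝ)} (hG : MeasurableSet G) :
    MeasurableSet (cellSet k n G) := by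
  have h1 : MeasurableSet {z : (Fin k → ℝ) × Deal n | ∀ i, 0 ≤ z.1 i} := by
    rw [Set.ofPred_forall]
    exact MeasurableSet.iInter fun i => measurableSet_le measurable_const
      ((measurable_pi_apply i).comp measurable_fst)
  have h2 : MeasurableSet {z : (Fin k → ℝ) × Deal n | scaledBlockLengths k n z.2 ∈ G} :=
    ((measurable_of_deal (scaledBlockLengths k n)).comp measurable_snd) hG
  have h3 : MeasurableSet {z : (Fin k → ℝ) × Deal n |
      ∀ i : Fin k, z.2.blockLength i = ⌊2 * √(n : ℝ) * z.1 i⌋₊ + 2} := by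
    rw [Set.ofPred_forall]
    refine MeasurableSet.iInter fun i => measurableSet_eq_fun ?_ ?_
    · exact (measurable_of_deal fun σ : Deal n => σ.blockLength i).comp measurable_snd
    · exact (Nat.measurable_floor.comp (measurable_const.mul
        ((measurable_pi_apply i).comp measurable_fst))).add_const _
  exact h1.inter (h2.inter h3)

lemma volume_cell_le (k : ℕ) {s : ℝ} (hs : 0 < s) (m : Fin k → ℕ) :
    volume {x : Fin k → ℝ | (∀ i, 0 ≤ x i) ∧ ∀ i, m i = ⌊s * x i⌋₊ + 2} ≤
      ENNReal.ofReal (s ^ k)⁻¹ := by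
  have hsub : {x : Fin k → ℝ | (∀ i, 0 ≤ x i) ∧ ∀ i, m i = ⌊s * x i⌋₊ + 2} ⊆
      Set.pi Set.univ fun i => Set.Ico (((m i : ℝ) - 2) / s) (((m i : ℝ) - 1) / s) := by
    rintro x ⟨hx, hm⟩ i -
    have h1 := Nat.floor_le (mul_nonneg hs.le (hx i))
    have h2 := Nat.lt_floor_add_one (s * x i)
    have h3 : (m i : ℝ) = ⌊s * x i⌋₊ + 2 := by exact_mod_cast hm i
    rw [Set.mem_Ico, div_le_iff₀ hs, lt_div_iff₀ hs, h3]
    constructor <;> linarith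
  refine (measure_mono hsub).trans (le_of_eq ?_)
  rw [Real.volume_pi_Ico]
  have : ∀ i, ((m i : ℝ) - 1) / s - ((m i : ℝ) - 2) / s = s⁻¹ := fun i => by
    rw [← sub_div, inv_eq_one_div]; congr 1; ring
  simp only [this, Finset.prod_const, Finset.card_univ, Fintype.card_fin]
  rw [← ENNReal.ofReal_pow (by positivity), inv_pow]

/-- By Tonelli, a game contributes (2√n)^k times the volume of its cell, at most one, and nothing
unless its scaled lengths lie in `G`. -/
lemma lintegral_cellSet_le (k : ℕ) {n : ℕ} (hn : 0 < n) {G : Set (Fin k → ℝ)}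
    (hG : MeasurableSet G) :
    ∫⁻ x, ENNReal.ofReal ((2 * √(n : ℝ)) ^ k) * randomGame n (Prod.mk x ⁻¹' cellSet k n G) ≤
      randomGame n (scaledBlockLengths k n ⁻¹' G) := by
  have hs : 0 < 2 * √(n : ℝ) := by positivity
  have hE := measurableSet_cellSet k n hG
  rw [lintegral_const_mul _ (measurable_measure_prodMk_left hE), ← Measure.prod_apply hE,
    Measure.prod_apply_symm hE]
  have hA : MeasurableSet (scaledBlockLengths k n ⁻¹' G) := measurable_of_deal _ hG
  have hle : ∀ σ : Deal n, volume ((fun x => (x, σ)) ⁻¹' cellSet k n G) ≤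
      (scaledBlockLengths k n ⁻¹' G).indicator
        (fun _ => ENNReal.ofReal ((2 * √(n : ℝ)) ^ k)⁻¹) σ := by
    intro σ
    by_cases hσ : scaledBlockLengths k n σ ∈ G
    · rw [Set.indicator_of_mem (show σ ∈ scaledBlockLengths k n ⁻¹' G from hσ)]
      refine le_trans (measure_mono ?_) (volume_cell_le k hs fun i => σ.blockLength i)
      rintro x ⟨h1, -, h2⟩
      exact ⟨h1, h2⟩
    · have : (fun x => (x, σ)) ⁻¹' cellSet k n G = ∅ := by
        ext x
        simp [cellSet, hσ]
      simp [this]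
  calc _ ≤ ENNReal.ofReal ((2 * √(n : ℝ)) ^ k) * ∫⁻ σ, (scaledBlockLengths k n ⁻¹' G).indicator
        (fun _ => ENNReal.ofReal ((2 * √(n : ℝ)) ^ k)⁻¹) σ ∂(randomGame n) := by
        gcongr with σ
        exact hle σ
    _ = _ := by
      rw [lintegral_indicator_const hA, ← mul_assoc, ← ENNReal.ofReal_mul (by positivity),
        mul_inv_cancel₀ (by positivity), ENNReal.ofReal_one, one_mul]

/-! ### Pointwise convergence to the density -/

/-- Extension of a finite vector by zero. -/
def extendZero {k : ℕ} (x : Fin k → ℝ) (i : ℕ) : ℝ := if h : i < k then x ⟨i, h⟩ else 0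

lemma extendZero_val {k : ℕ} (x : Fin k → ℝ) (i : Fin k) : extendZero x i = x i := by
  simp [extendZero]

lemma limitDensity_eq {k : ℕ} {x : Fin k → ℝ} (hx : ∀ i, 0 ≤ x i) :
    limitDensity k x =
      (∏ i ∈ Finset.range k, 2 * ∑ j ∈ Finset.range (i + 1), extendZero x j) *
        Real.exp (-(∑ j ∈ Finset.range k, extendZero x j) ^ 2) := by
  have h1 : ∀ i : Fin k, ∑ j ∈ Finset.range (i.val + 1), extendZero x j =
      ∑ j ∈ Finset.Iic i, x j := by
    intro i
    rw [Nat.range_succ_eq_Iic, ← Fin.map_valEmbedding_Iic, Finset.sum_map]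
    simp [extendZero_val]
  rw [limitDensity, if_pos hx, Finset.prod_mul_distrib, Finset.prod_const, Finset.card_range,
    Finset.prod_range, Finset.sum_range]
  simp only [h1, extendZero_val]

/-- The block lengths of the lattice cell containing the point `x`. -/
def cellLengths {k : ℕ} (x : Fin k → ℝ) (n i : ℕ) : ℕ := ⌊2 * √(n : ℝ) * extendZero x i⌋₊ + 2

lemma tendsto_two_sqrt : Tendsto (fun n : ℕ => 2 * √(n : ℝ)) atTop atTop :=
  (Real.tendsto_sqrt_atTop.comp tendsto_natCast_atTop_atTop).const_mul_atTop two_pos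

lemma tendsto_cellLengths {k : ℕ} {x : Fin k → ℝ} (hx : ∀ i, 0 ≤ x i) (i : ℕ) :
    Tendsto (fun n : ℕ => (cellLengths x n i : ℝ) / (2 * √(n : ℝ))) atTop
      (nhds (extendZero x i)) := by
  have h0 : 0 ≤ extendZero x i := by
    unfold extendZero
    split_ifs
    exacts [hx _, le_rfl]
  have h1 := (tendsto_nat_floor_mul_div_atTop h0).comp tendsto_two_sqrt
  -- The shift by 2 in `cellLengths` vanishes after scaling.
  have h2 := h1.add (tendsto_two_sqrt.const_div_atTop 2)
  rw [add_zero] at h2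
  refine h2.congr fun n => ?_
  simp only [Function.comp, cellLengths]
  push_cast
  rw [add_div, mul_comm (extendZero x i)]

lemma tendsto_partialSum_cellLengths {k : ℕ} {x : Fin k → ℝ} (hx : ∀ i, 0 ≤ x i) (j : ℕ) :
    Tendsto (fun n : ℕ => (partialSum (cellLengths x n) j : ℝ) / (2 * √(n : ℝ))) atTop
      (nhds (∑ i ∈ Finset.range j, extendZero x i)) := by
  refine (tendsto_finsetSum (Finset.range j) fun i _ => tendsto_cellLengths hx i).congr
    fun n => ?_
  rw [partialSum, ← Finset.sum_div]
  push_cast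
  rfl

lemma tendsto_partialSum_div {k : ℕ} {x : Fin k → ℝ} (hx : ∀ i, 0 ≤ x i) (j : ℕ) :
    Tendsto (fun n : ℕ => (partialSum (cellLengths x n) j : ℝ) / n) atTop (nhds 0) := by
  have h := (tendsto_partialSum_cellLengths hx j).mul (tendsto_two_sqrt.const_div_atTop 4)
  rw [mul_zero] at h
  refine h.congr' ?_
  filter_upwards [eventually_gt_atTop 0] with n hn
  have hn' : (0 : ℝ) < n := by exact_mod_cast hn
  have h1 : (2 * √(n : ℝ)) * (2 * √(n : ℝ)) = 4 * n := by
    rw [mul_mul_mul_comm, Real.mul_self_sqrt hn'.le]; norm_num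
  rw [div_mul_div_comm, h1, mul_comm (4 : ℝ), mul_div_mul_right _ _ (by norm_num : (4 : ℝ) ≠ 0)]

/-- The lower bound for the joint probability mass function, rescaled, tends to the density. -/
lemma tendsto_lowerBound {k : ℕ} {x : Fin k → ℝ} (hx : ∀ i, 0 ≤ x i) :
    Tendsto (fun n : ℕ => (2 * √(n : ℝ)) ^ k *
      ((∏ i ∈ Finset.range k,
          ((partialSum (cellLengths x n) (i + 1) : ℝ) - 1 - 2 * i) / (2 * n)) *
        Real.exp (-((partialSum (cellLengths x n) k : ℝ) ^ 2 /
          (4 * (n - partialSum (cellLengths x n) k)))))) atTop (nhds (limitDensity k x)) := by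
  rw [limitDensity_eq hx]
  -- One factor 2√n goes to each red factor; (2√n)² = 4n leaves the 2.
  have h1 : Tendsto (fun n : ℕ => ∏ i ∈ Finset.range k,
      2 * ((partialSum (cellLengths x n) (i + 1) : ℝ) / (2 * √(n : ℝ)) -
        (1 + 2 * i) / (2 * √(n : ℝ)))) atTop
      (nhds (∏ i ∈ Finset.range k, 2 * ∑ j ∈ Finset.range (i + 1), extendZero x j)) := by
    refine tendsto_finsetProd _ fun i _ => Tendsto.const_mul _ ?_
    have := (tendsto_partialSum_cellLengths hx (i + 1)).sub
      (tendsto_two_sqrt.const_div_atTop (1 + 2 * (i : ℝ)))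
    rwa [sub_zero] at this
  -- S²/(4(n - S)) is rewritten as (S/(2√n))²/(1 - S/n), where S/n tends to 0.
  have h2 : Tendsto (fun n : ℕ => Real.exp (-(((partialSum (cellLengths x n) k : ℝ) /
      (2 * √(n : ℝ))) ^ 2 / (1 - (partialSum (cellLengths x n) k : ℝ) / n)))) atTop
      (nhds (Real.exp (-(∑ j ∈ Finset.range k, extendZero x j) ^ 2))) := by
    refine (Real.continuous_exp.tendsto _).comp (Tendsto.neg ?_)
    have := ((tendsto_partialSum_cellLengths hx k).pow 2).div
      ((tendsto_partialSum_div hx k).const_sub 1) (by norm_num)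
    rwa [sub_zero, div_one] at this
  refine (h1.mul h2).congr' ?_
  filter_upwards [eventually_gt_atTop 0] with n hn
  have hn' : (0 : ℝ) < n := by exact_mod_cast hn
  have hs : 0 < √(n : ℝ) := Real.sqrt_pos.2 hn'
  have hsq : √(n : ℝ) ^ 2 = n := Real.sq_sqrt hn'.le
  rw [← mul_assoc]
  congr 1
  · have hpow : (2 * √(n : ℝ)) ^ k = ∏ _i ∈ Finset.range k, 2 * √(n : ℝ) := by simp
    rw [hpow, ← Finset.prod_mul_distrib]
    refine Finset.prod_congr rfl fun i _ => ?_
    rw [← sub_div, mul_div_assoc', mul_div_assoc', div_eq_div_iff (by positivity) (by positivity)]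
    linear_combination
      -4 * ((partialSum (cellLengths x n) (i + 1) : ℝ) - 1 - 2 * i) * hsq
  · congr 2
    rw [div_pow, mul_pow, hsq, one_sub_div hn'.ne', div_div_div_eq]
    rw [show (2 ^ 2 * n * (n - partialSum (cellLengths x n) k) : ℝ) =
      4 * (n - partialSum (cellLengths x n) k) * n by ring, mul_div_mul_right _ _ hn'.ne']

/-! ### Fatou's lemma and the portmanteau theorem -/

lemma le_liminf_cellSet {k : ℕ} {x : Fin k → ℝ} (hx : ∀ i, 0 ≤ x i) {G : Set (Fin k → ℝ)}
    (hG : IsOpen G) (hxG : x ∈ G) :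
    ENNReal.ofReal (limitDensity k x) ≤ liminf (fun n : ℕ => ENNReal.ofReal ((2 * √(n : ℝ)) ^ k) *
      randomGame n (Prod.mk x ⁻¹' cellSet k n G)) atTop := by
  have hlim := ENNReal.tendsto_ofReal (tendsto_lowerBound hx)
  rw [← hlim.liminf_eq]
  refine liminf_le_liminf ?_
  have hmem : ∀ᶠ n : ℕ in atTop,
      (fun i : Fin k => (cellLengths x n i : ℝ) / (2 * √(n : ℝ))) ∈ G := by
    have : Tendsto (fun n : ℕ => fun i : Fin k => (cellLengths x n i : ℝ) / (2 * √(n : ℝ))) atTop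
        (nhds x) := by
      rw [tendsto_pi_nhds]
      intro i
      have := tendsto_cellLengths hx i
      rwa [extendZero_val] at this
    exact this.eventually (hG.mem_nhds hxG)
  filter_upwards [hmem, (tendsto_partialSum_div hx k).eventually (gt_mem_nhds one_pos),
    eventually_gt_atTop 0] with n hnG hlt hn
  have hn' : (0 : ℝ) < n := by exact_mod_cast hn
  have hlt' : partialSum (cellLengths x n) k < n := by
    rw [div_lt_one hn'] at hlt
    exact_mod_cast hlt
  rw [ENNReal.ofReal_mul (by positivity)]
  gcongr
  -- The shift by 2 in `cellLengths` supplies the required minimal block length.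
  refine (le_randomGame_blockLength (fun i => by simp [cellLengths]) hlt').trans
    (measure_mono fun σ hσ => ?_)
  have hσ' : ∀ i : Fin k, σ.blockLength i = cellLengths x n i := fun i => hσ i i.2
  refine ⟨hx, ?_, fun i => ?_⟩
  · have : scaledBlockLengths k n σ = fun i : Fin k => (cellLengths x n i : ℝ) / (2 * √(n : ℝ)) := by
      funext i
      rw [scaledBlockLengths, hσ' i]
    rwa [this]
  · rw [hσ' i, cellLengths, extendZero_val]

/-- Fatou's lemma needs no domination, so the pointwise lower bound on cells suffices. -/
lemma limitLaw_le_liminf (k : ℕ) {G : Set (Fin k → ℝ)} (hG : IsOpen G) :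
    limitLaw k G ≤ liminf (fun n => randomGame n (scaledBlockLengths k n ⁻¹' G)) atTop := by
  calc limitLaw k G = ∫⁻ x, G.indicator (fun x => ENNReal.ofReal (limitDensity k x)) x := by
        rw [limitLaw, withDensity_apply _ hG.measurableSet,
          lintegral_indicator hG.measurableSet]
    _ ≤ ∫⁻ x, liminf (fun n : ℕ => ENNReal.ofReal ((2 * √(n : ℝ)) ^ k) *
          randomGame n (Prod.mk x ⁻¹' cellSet k n G)) atTop := by
        refine lintegral_mono fun x => ?_
        by_cases hxG : x ∈ G
        swap
        · simp [hxG]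
        rw [Set.indicator_of_mem hxG]
        by_cases hx : ∀ i, 0 ≤ x i
        · exact le_liminf_cellSet hx hG hxG
        · simp [limitDensity, if_neg hx]
    _ ≤ liminf (fun n : ℕ => ∫⁻ x, ENNReal.ofReal ((2 * √(n : ℝ)) ^ k) *
          randomGame n (Prod.mk x ⁻¹' cellSet k n G)) atTop :=
        lintegral_liminf_le fun n => (measurable_measure_prodMk_left
          (measurableSet_cellSet k n hG.measurableSet)).const_mul _
    _ ≤ _ := by
        refine liminf_le_liminf ?_
        filter_upwards [eventually_gt_atTop 0] with n hn
        exact lintegral_cellSet_le k hn hG.measurableSet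

end MemoryGame

end

theorem theorem2p5 (k : ℕ) (hk : 0 < k) :
    ∃ _ : IsProbabilityMeasure (MemoryGame.limitLaw k),
      TendstoInDistribution (fun n : ℕ => MemoryGame.scaledBlockLengths k n) atTop
        (id : (Fin k → ℝ) → (Fin k → ℝ)) MemoryGame.randomGame (MemoryGame.limitLaw k) := by
  have hmeas : ∀ n, Measurable (MemoryGame.scaledBlockLengths k n) := fun n =>
    MemoryGame.measurable_of_deal _
  have hprob := MemoryGame.isProbabilityMeasure_limitLaw k
  refine ⟨hprob, fun n => (hmeas n).aemeasurable,
    aemeasurable_id, ?_⟩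
  refine tendsto_of_forall_isOpen_le_liminf' fun G hG => ?_
  simpa only [ProbabilityMeasure.coe_mk, Measure.map_id,
    Measure.map_apply (hmeas _) hG.measurableSet] using MemoryGame.limitLaw_le_liminf k hG
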